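/- Let $\mathbb{K}$ be a field of characteristic $0$, and let $\mathcal{D}$ be a non-empty class of finite groups closed under isomorphisms, subgroups, quotients and direct products (for example, all finite groups). Let $\mathbb{K}\mathcal{D}$ be the category whose objects are the groups in $\mathcal{D}$, with $\mathrm{Hom}(G,H)=\mathbb{K}\otimes_{\mathbb{Z}}B(H,G)$, where $B(H,G)$ is the Grothendieck group of finite $(H,G)$-bisets with respect to disjoint union, and with composition induced by the tensor product of bisets. Let $A$ be a Green biset functor over $\mathbb{K}\mathcal{D}$, that is, a $\mathbb{K}$-linear functor from $\mathbb{K}\mathcal{D}$ to $\mathbb{K}$-modules such that each $A(G)$ is a unital associative $\mathbb{K}$-algebra and, for every group homomorphism $\phi:K\to G$ between groups in $\mathcal{D}$, the map $\phi^{*}=A({}_{K^\phi}G_G):A(G)\to A(K)$ is a unital ring homomorphism and the map $\phi_{*}=A({}_GG_{{}^\phi K}):A(K)\to A(G)$ satisfies $\phi_*(a)\cdot b=\phi_*(a\cdot\phi^*(b))$ and $b\cdot\phi_*(a)=\phi_*(\phi^*(b)\cdot a)$ for all $a\in A(K)$, $b\in A(G)$. (Here ${}_{K^\phi}G_G$ and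 ${}_GG_{{}^\phi K}$ denote the set $G$, with $G$ acting by multiplication and $K$ acting by multiplication through $\phi$, on the sides indicated.) Assume that for every $G$ in $\mathcal{D}$ the algebra $A(G)$ is a finite dimensional split semisimple commutative $\mathbb{K}$-algebra, and let $E_G$ be the set of primitive idempotents of $A(G)$. Let $G$ be a group in $\mathcal{D}$. Write $Res^G_H$ for the $(H,G)$-biset $G$ and $Ind^G_H$ for the $(G,H)$-biset $G$ when $H\le G$; $Inf^G_{G/N}$ for the $(G,G/N)$-biset $G/N$ and $Def^G_{G/N}$ for the $(G/N,G)$-biset $G/N$ when $N\trianglelefteq G$; and $Iso\,\phi$ for the $(G',G)$-biset $G'$, with $G$ acting through $\phi$, when $\phi:G\to G'$ is an isomorphism. (a) If $H$ is a subgroup of $G$ and $e\in E_G$, then $A(Res^G_H)(e)=\sum_{s\in\Omega}s$ for some subset $\Omega\subseteq E_H$. (b) If $H$ is a subgroup of $G$ and $t\in E_H$, then there exist $e\in E_G$ and $\lambda\in\mathbb{K}$ such that $A(Ind^G_H)(t)=\lambda e$. (c) If $N$ is a normal subgroup of $G$ and $e\in E_{G/N}$, then $A(Inf^G_{G/N})(e)=\sum_{t\in\Omega}t$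 for some subset $\Omega\subseteq E_G$. (d) If $N$ is a normal subgroup of $G$ and $e\in E_G$, then there exist $\lambda\in\mathbb{K}$ and $t\in E_{G/N}$ such that $A(Def^G_{G/N})(e)=\lambda t$. (e) If $\phi:G\to G'$ is an isomorphism of groups in $\mathcal{D}$ and $e\in E_G$, then $A(Iso\,\phi)(e)=e'$ for some $e'\in E_{G'}$. The subsets $\Omega$ may be empty and the scalars $\lambda$ may be $0$. -/

import Mathlib

open CategoryTheory
open scoped TensorProduct

universe u v w

/-! ### Bisets and the Grothendieck group of bisets -/

/-- A finite `(H, G)`-biset: a finite set with a left action of `H` and a right action of `G`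
(that is, an action of the opposite group `Gᵐᵒᵖ`) that commute. -/
structure Biset (H G : Type u) [Group H] [Group G] where
  carrier : Type u
  [left : MulAction H carrier]
  [right : MulAction Gᵐᵒᵖ carrier]
  [comm : SMulCommClass H Gᵐᵒᵖ carrier]
  [finite : Finite carrier]

attribute [instance] Biset.left Biset.right Biset.comm Biset.finite

namespace Biset

section

variable {L K H G : Type u} [Group L] [Group K] [Group H] [Group G]

/-- Isomorphism of bisets: existence of a bijection that commutes with both actions. -/
def Isomorphic (U V : Biset H G) : Prop :=
  ∃ e : U.carrier ≃ V.carrier, (∀ (h : H) (x : U.carrier), e (h • x) = h • e x) ∧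
    ∀ (g : Gᵐᵒᵖ) (x : U.carrier), e (g • x) = g • e x

theorem Isomorphic.refl (U : Biset H G) : Isomorphic U U :=
  ⟨Equiv.refl _, fun _ _ => rfl, fun _ _ => rfl⟩

theorem Isomorphic.symm {U V : Biset H G} : Isomorphic U V → Isomorphic V U := by
  rintro ⟨e, h1, h2⟩
  refine ⟨e.symm, fun h x => ?_, fun g x => ?_⟩
  · rw [Equiv.symm_apply_eq, h1, Equiv.apply_symm_apply]
  · rw [Equiv.symm_apply_eq, h2, Equiv.apply_symm_apply]

theorem Isomorphic.trans {U V W : Biset H G} :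
    Isomorphic U V → Isomorphic V W → Isomorphic U W := by
  rintro ⟨e, h1, h2⟩ ⟨f, h3, h4⟩
  exact ⟨e.trans f, fun h x => by simp [h1, h3], fun g x => by simp [h2, h4]⟩

instance setoid (H G : Type u) [Group H] [Group G] : Setoid (Biset H G) where
  r := Isomorphic
  iseqv := ⟨Isomorphic.refl, Isomorphic.symm, Isomorphic.trans⟩

/-- The disjoint union of two bisets. -/
def sum (U V : Biset H G) : Biset H G where
  carrier := U.carrier ⊕ V.carrier

/-- The empty biset. -/
def empty (H G : Type u) [Group H] [Group G] : Biset H G where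
  carrier := PEmpty
  left := { smul := fun _ x => x, one_smul := fun x => x.elim, mul_smul := fun _ _ x => x.elim }
  right := { smul := fun _ x => x, one_smul := fun x => x.elim, mul_smul := fun _ _ x => x.elim }
  comm := @SMulCommClass.mk _ _ _ (_) (_) fun _ _ x => x.elim

/-- The identity `(G, G)`-biset: `G` acting on itself by left and right multiplication. -/
def id (G : Type u) [Group G] [Finite G] : Biset G G where
  carrier := G

/-- The equivalence relation `(u h, v) ~ (u, h v)` on the product of a `(K, H)`-biset
and an `(H, G)`-biset. -/
def tensorSetoid (U : Biset K H) (V : Biset H G) : Setoid (U.carrier × V.carrier) where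
  r p q := ∃ h : H, p.1 = MulOpposite.op h • q.1 ∧ q.2 = h • p.2
  iseqv :=
    { refl := fun p => ⟨1, by simp, by simp⟩
      symm := by
        rintro p q ⟨h, h1, h2⟩
        exact ⟨h⁻¹, by rw [h1, smul_smul]; simp,
          by rw [h2, smul_smul]; simp⟩
      trans := by
        rintro p q r ⟨h, h1, h2⟩ ⟨k, h3, h4⟩
        exact ⟨k * h, by rw [h1, h3, smul_smul, MulOpposite.op_mul],
          by rw [h4, h2, smul_smul]⟩ }

/-- The underlying set of the tensor product `U ×_H V`. -/
def TensorCarrier (U : Biset K H) (V : Biset H G) : Type u := Quotient (tensorSetoid U V)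

/-- The class of the pair `(u, v)` in `U ×_H V`. -/
def tmk (U : Biset K H) (V : Biset H G) (x : U.carrier) (y : V.carrier) : TensorCarrier U V :=
  Quotient.mk (tensorSetoid U V) (x, y)

theorem tmk_eq (U : Biset K H) (V : Biset H G) (h : H) (x : U.carrier) (y : V.carrier) :
    tmk U V (MulOpposite.op h • x) y = tmk U V x (h • y) :=
  Quotient.sound (s := tensorSetoid U V) ⟨h, rfl, rfl⟩

/-- Maps out of `U ×_H V`. -/
def tlift {U : Biset K H} {V : Biset H G} {α : Sort*} (f : U.carrier → V.carrier → α)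
    (hf : ∀ (h : H) x y, f (MulOpposite.op h • x) y = f x (h • y)) : TensorCarrier U V → α :=
  Quotient.lift (s := tensorSetoid U V) (fun p => f p.1 p.2) (by
    rintro ⟨a, b⟩ ⟨c, d⟩ ⟨h, h1, h2⟩
    simp only at h1 h2 ⊢
    rw [h1, h2, hf])

@[simp] theorem tlift_tmk {U : Biset K H} {V : Biset H G} {α : Sort*}
    (f : U.carrier → V.carrier → α)
    (hf : ∀ (h : H) x y, f (MulOpposite.op h • x) y = f x (h • y)) (x y) :
    tlift f hf (tmk U V x y) = f x y := rfl

theorem tind {U : Biset K H} {V : Biset H G} {P : TensorCarrier U V → Prop}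
    (h : ∀ x y, P (tmk U V x y)) (z : TensorCarrier U V) : P z :=
  Quotient.ind (s := tensorSetoid U V) (fun p => h p.1 p.2) z

instance (U : Biset K H) (V : Biset H G) : MulAction K (TensorCarrier U V) where
  smul k := tlift (fun x y => tmk U V (k • x) y) (fun h x y => by rw [smul_comm, tmk_eq])
  one_smul := tind fun x y => congrArg (fun t => tmk U V t y) (one_smul K x)
  mul_smul a b := tind fun x y => congrArg (fun t => tmk U V t y) (mul_smul a b x)

instance (U : Biset K H) (V : Biset H G) : MulAction Gᵐᵒᵖ (TensorCarrier U V) where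
  smul g := tlift (fun x y => tmk U V x (g • y)) (fun h x y => by rw [tmk_eq, smul_comm])
  one_smul := tind fun x y => congrArg (fun t => tmk U V x t) (one_smul Gᵐᵒᵖ y)
  mul_smul a b := tind fun x y => congrArg (fun t => tmk U V x t) (mul_smul a b y)

instance (U : Biset K H) (V : Biset H G) : SMulCommClass K Gᵐᵒᵖ (TensorCarrier U V) :=
  ⟨fun _ _ => tind fun _ _ => rfl⟩

instance (U : Biset K H) (V : Biset H G) : Finite (TensorCarrier U V) :=
  inferInstanceAs (Finite (Quotient (tensorSetoid U V)))

/-- The tensor product `U ×_H V` of a `(K, H)`-biset and an `(H, G)`-biset: the quotient of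
`U × V` by `(u h, v) ~ (u, h v)`, with `k (u, v) g = (k u, v g)`. -/
def tensor (U : Biset K H) (V : Biset H G) : Biset K G where
  carrier := TensorCarrier U V

/-- Constructor for isomorphisms from a pair of inverse maps, the first one equivariant. -/
theorem Isomorphic.mk' {U V : Biset H G} (f : U.carrier → V.carrier) (f' : V.carrier → U.carrier)
    (h1 : ∀ x, f' (f x) = x) (h2 : ∀ x, f (f' x) = x)
    (h3 : ∀ (h : H) x, f (h • x) = h • f x) (h4 : ∀ (g : Gᵐᵒᵖ) x, f (g • x) = g • f x) :
    Isomorphic U V := ⟨⟨f, f', h1, h2⟩, h3, h4⟩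

theorem sum_congr {U U' V V' : Biset H G} :
    Isomorphic U U' → Isomorphic V V' → Isomorphic (sum U V) (sum U' V') := by
  rintro ⟨e, h1, h2⟩ ⟨f, h3, h4⟩
  refine ⟨Equiv.sumCongr e f, ?_, ?_⟩
  · rintro h (x | x)
    · exact congrArg Sum.inl (h1 h x)
    · exact congrArg Sum.inr (h3 h x)
  · rintro h (x | x)
    · exact congrArg Sum.inl (h2 h x)
    · exact congrArg Sum.inr (h4 h x)

theorem sum_comm (U V : Biset H G) : Isomorphic (sum U V) (sum V U) :=
  ⟨Equiv.sumComm _ _, by rintro h (x | x) <;> rfl, by rintro h (x | x) <;> rfl⟩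

theorem sum_assoc (U V W : Biset H G) :
    Isomorphic (sum (sum U V) W) (sum U (sum V W)) :=
  ⟨Equiv.sumAssoc _ _ _, by rintro h ((x | x) | x) <;> rfl, by rintro h ((x | x) | x) <;> rfl⟩

theorem empty_sum (U : Biset H G) : Isomorphic (sum (empty H G) U) U :=
  Isomorphic.mk' (U := sum (empty H G) U) (Sum.elim PEmpty.elim fun x => x) Sum.inr
    (by rintro (x | x); exacts [x.elim, rfl]) (fun _ => rfl)
    (by rintro h (x | x); exacts [x.elim, rfl]) (by rintro h (x | x); exacts [x.elim, rfl])

theorem tensor_congr {U U' : Biset K H} {V V' : Biset H G} :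
    Isomorphic U U' → Isomorphic V V' → Isomorphic (tensor U V) (tensor U' V') := by
  rintro ⟨e, h1, h2⟩ ⟨f, h3, h4⟩
  have h2' : ∀ (g : Hᵐᵒᵖ) x, e.symm (g • x) = g • e.symm x := fun g x => by
    rw [Equiv.symm_apply_eq, h2, Equiv.apply_symm_apply]
  have h3' : ∀ (g : H) x, f.symm (g • x) = g • f.symm x := fun g x => by
    rw [Equiv.symm_apply_eq, h3, Equiv.apply_symm_apply]
  refine Isomorphic.mk' (U := tensor U V) (V := tensor U' V')
    (tlift (fun x y => tmk U' V' (e x) (f y)) fun h x y => by rw [h2, h3, tmk_eq])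
    (tlift (fun x y => tmk U V (e.symm x) (f.symm y)) fun h x y => by rw [h2', h3', tmk_eq])
    (tind fun x y => congrArg₂ (tmk U V) (e.symm_apply_apply x) (f.symm_apply_apply y))
    (tind fun x y => congrArg₂ (tmk U' V') (e.apply_symm_apply x) (f.apply_symm_apply y))
    (fun k => tind fun x y => congrArg (fun t => tmk U' V' t (f y)) (h1 k x))
    (fun g => tind fun x y => congrArg (fun t => tmk U' V' (e x) t) (h4 g y))

theorem tensor_assoc (W : Biset L K) (U : Biset K H) (V : Biset H G) :
    Isomorphic (tensor (tensor W U) V) (tensor W (tensor U V)) :=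
  Isomorphic.mk' (U := tensor (tensor W U) V) (V := tensor W (tensor U V))
    (tlift (U := tensor W U) (V := V)
      (fun p y => tlift (fun a x => tmk W (tensor U V) a (tmk U V x y))
        (fun k a x => tmk_eq W (tensor U V) k a (tmk U V x y)) p)
      (fun h => tind fun a x => fun y =>
        congrArg (fun t => tmk W (tensor U V) a t) (tmk_eq U V h x y)))
    (tlift (U := W) (V := tensor U V)
      (fun a p => tlift (fun x y => tmk (tensor W U) V (tmk W U a x) y)
        (fun h x y => tmk_eq (tensor W U) V h (tmk W U a x) y) p)
      (fun k a => tind fun x y =>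
        congrArg (fun t => tmk (tensor W U) V t y) (tmk_eq W U k a x)))
    (tind fun p y => tind (P := fun p => tlift _ _ (tlift _ _ (tmk (tensor W U) V p y)) =
      tmk (tensor W U) V p y) (fun _ _ => rfl) p)
    (tind fun a p => tind (P := fun p => tlift _ _ (tlift _ _ (tmk W (tensor U V) a p)) =
      tmk W (tensor U V) a p) (fun _ _ => rfl) p)
    (fun l => tind fun p y => by
      revert p
      exact tind (U := W) (V := U) fun _ _ => rfl)
    (fun g => tind fun p y => by
      revert p
      exact tind (U := W) (V := U) fun _ _ => rfl)

theorem id_tensor [Finite H] (V : Biset H G) : Isomorphic (tensor (id H) V) V :=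
  Isomorphic.mk' (U := tensor (id H) V)
    (tlift (U := id H) (fun (x : H) y => x • y) fun h (x : H) y => mul_smul x h y)
    (fun y => tmk (id H) V (1 : H) y)
    (tind fun (x : H) y => by
      refine (tmk_eq (id H) V x (1 : H) y).symm.trans ?_
      exact congrArg (fun t : H => tmk (id H) V t y) (one_mul x))
    (fun y => one_smul H y)
    (fun h => tind fun (x : H) y => mul_smul h x y)
    (fun g => tind fun (x : H) y => smul_comm x g y)

theorem tensor_id [Finite H] (V : Biset G H) : Isomorphic (tensor V (id H)) V :=
  Isomorphic.mk' (U := tensor V (id H))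
    (tlift (V := id H) (fun y (x : H) => MulOpposite.op x • y) fun h y (x : H) => by
      rw [smul_smul]; rfl)
    (fun y => tmk V (id H) y (1 : H))
    (tind fun y (x : H) => by
      refine (tmk_eq V (id H) x y (1 : H)).trans ?_
      exact congrArg (fun t : H => tmk V (id H) y t) (mul_one x))
    (fun y => one_smul Hᵐᵒᵖ y)
    (fun h => tind fun y (x : H) => (smul_comm h (MulOpposite.op x) y).symm)
    (fun g => tind fun y (x : H) => by
      exact mul_smul g (MulOpposite.op x) y)

theorem sum_tensor (U U' : Biset K H) (V : Biset H G) :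
    Isomorphic (tensor (sum U U') V) (sum (tensor U V) (tensor U' V)) :=
  Isomorphic.mk' (U := tensor (sum U U') V) (V := sum (tensor U V) (tensor U' V))
    (tlift (U := sum U U') (V := V)
      (fun x y => Sum.elim (fun a => Sum.inl (tmk U V a y)) (fun a => Sum.inr (tmk U' V a y)) x)
      (by
        rintro h (x | x) y
        · exact congrArg Sum.inl (tmk_eq U V h x y)
        · exact congrArg Sum.inr (tmk_eq U' V h x y)))
    (Sum.elim
      (tlift (fun x y => tmk (sum U U') V (Sum.inl x) y)
        (fun h x y => tmk_eq (sum U U') V h (Sum.inl x) y))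
      (tlift (fun x y => tmk (sum U U') V (Sum.inr x) y)
        (fun h x y => tmk_eq (sum U U') V h (Sum.inr x) y)))
    (tind fun x y => by rcases x with x | x <;> rfl)
    (by
      rintro (p | p)
      · exact tind (U := U) (V := V) (P := fun p => tlift _ _ (Sum.elim _ _ (Sum.inl p)) =
          Sum.inl p) (fun _ _ => rfl) p
      · exact tind (U := U') (V := V) (P := fun p => tlift _ _ (Sum.elim _ _ (Sum.inr p)) =
          Sum.inr p) (fun _ _ => rfl) p)
    (fun k => tind fun x y => by rcases x with x | x <;> rfl)
    (fun g => tind fun x y => by rcases x with x | x <;> rfl)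

theorem tensor_sum (U : Biset K H) (V V' : Biset H G) :
    Isomorphic (tensor U (sum V V')) (sum (tensor U V) (tensor U V')) :=
  Isomorphic.mk' (U := tensor U (sum V V')) (V := sum (tensor U V) (tensor U V'))
    (tlift (U := U) (V := sum V V')
      (fun x y => Sum.elim (fun a => Sum.inl (tmk U V x a)) (fun a => Sum.inr (tmk U V' x a)) y)
      (by
        rintro h x (y | y)
        · exact congrArg Sum.inl (tmk_eq U V h x y)
        · exact congrArg Sum.inr (tmk_eq U V' h x y)))
    (Sum.elim
      (tlift (fun x y => tmk U (sum V V') x (Sum.inl y))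
        (fun h x y => tmk_eq U (sum V V') h x (Sum.inl y)))
      (tlift (fun x y => tmk U (sum V V') x (Sum.inr y))
        (fun h x y => tmk_eq U (sum V V') h x (Sum.inr y))))
    (tind fun x y => by rcases y with y | y <;> rfl)
    (by
      rintro (p | p)
      · exact tind (U := U) (V := V) (P := fun p => tlift _ _ (Sum.elim _ _ (Sum.inl p)) =
          Sum.inl p) (fun _ _ => rfl) p
      · exact tind (U := U) (V := V') (P := fun p => tlift _ _ (Sum.elim _ _ (Sum.inr p)) =
          Sum.inr p) (fun _ _ => rfl) p)
    (fun k => tind fun x y => by rcases y with y | y <;> rfl)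
    (fun g => tind fun x y => by rcases y with y | y <;> rfl)

theorem empty_tensor (V : Biset H G) : Isomorphic (tensor (empty K H) V) (empty K G) :=
  Isomorphic.mk' (U := tensor (empty K H) V) (V := empty K G)
    (tlift (U := empty K H) (fun x _ => x) fun _ x _ => PEmpty.elim x) (fun x => PEmpty.elim x)
    (tind fun x _ => PEmpty.elim x) (fun x => PEmpty.elim x)
    (fun _ => tind fun x _ => PEmpty.elim x) (fun _ => tind fun x _ => PEmpty.elim x)

theorem tensor_empty (U : Biset K H) : Isomorphic (tensor U (empty H G)) (empty K G) :=
  Isomorphic.mk' (U := tensor U (empty H G)) (V := empty K G)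
    (tlift (V := empty H G) (fun _ x => x) fun _ _ x => PEmpty.elim x) (fun x => PEmpty.elim x)
    (tind fun _ x => PEmpty.elim x) (fun x => PEmpty.elim x)
    (fun _ => tind fun _ x => PEmpty.elim x) (fun _ => tind fun _ x => PEmpty.elim x)

/-- The left action `k · x = φ(k) x` of `K` on `G`. -/
abbrev leftAction (φ : K →* G) : MulAction K G where
  smul k x := φ k * x
  one_smul x := by change φ 1 * x = x; simp
  mul_smul a b x := by change φ (a * b) * x = φ a * (φ b * x); rw [map_mul, mul_assoc]

/-- The right action `x · k = x φ(k)` of `K` on `G`. -/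
abbrev rightAction (φ : K →* G) : MulAction Kᵐᵒᵖ G where
  smul k x := x * φ k.unop
  one_smul x := by change x * φ 1 = x; simp
  mul_smul a b x := by
    change x * φ (b.unop * a.unop) = (x * φ b.unop) * φ a.unop
    rw [map_mul, mul_assoc]

/-- For a group homomorphism `φ : K → G`, the `(K, G)`-biset `G` with
`k · x · g = φ(k) x g`. -/
def resHom [Finite G] (φ : K →* G) : Biset K G :=
  letI := leftAction φ
  { carrier := G
    comm := ⟨fun k x g => (mul_assoc (φ k) g x.unop).symm⟩ }

/-- For a group homomorphism `φ : K → G`, the `(G, K)`-biset `G` with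
`g · x · k = g x φ(k)`. -/
def indHom [Finite G] (φ : K →* G) : Biset G K :=
  letI := rightAction φ
  { carrier := G
    left := Monoid.toMulAction G
    comm := ⟨fun g k x => (mul_assoc g x (φ k.unop)).symm⟩ }

end

end Biset

/-- Isomorphism classes of finite `(H, G)`-bisets. -/
def BisetClass (H G : Type u) [Group H] [Group G] : Type (u + 1) :=
  Quotient (Biset.setoid H G)

namespace BisetClass

variable {L K H G : Type u} [Group L] [Group K] [Group H] [Group G]

/-- The isomorphism class of a biset. -/
def mk (U : Biset H G) : BisetClass H G := Quotient.mk (Biset.setoid H G) U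

theorem sound {U V : Biset H G} (h : Biset.Isomorphic U V) : mk U = mk V :=
  Quotient.sound (s := Biset.setoid H G) h

theorem ind {P : BisetClass H G → Prop} (h : ∀ U, P (mk U)) (x : BisetClass H G) : P x :=
  Quotient.ind (s := Biset.setoid H G) h x

/-- Isomorphism classes of bisets form a commutative monoid under disjoint union. -/
instance : Zero (BisetClass H G) := ⟨mk (Biset.empty H G)⟩

instance : Add (BisetClass H G) :=
  ⟨Quotient.map₂ Biset.sum fun _ _ h _ _ h' => Biset.sum_congr h h'⟩

instance : AddCommMonoid (BisetClass H G) where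
  add_assoc a b c := by
    induction a using ind; induction b using ind; induction c using ind
    exact sound (Biset.sum_assoc _ _ _)
  zero_add a := by
    induction a using ind
    exact sound (Biset.empty_sum _)
  add_zero a := by
    induction a using ind
    exact sound ((Biset.sum_comm _ _).trans (Biset.empty_sum _))
  add_comm a b := by
    induction a using ind; induction b using ind
    exact sound (Biset.sum_comm _ _)
  nsmul := nsmulRec


/-- The biadditive map induced by the tensor product of bisets on isomorphism classes. -/
def comp : BisetClass K H →+ BisetClass H G →+ BisetClass K G where
  toFun x :=
    { toFun := fun y => Quotient.map₂ Biset.tensor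
        (fun _ _ h _ _ h' => Biset.tensor_congr h h') x y
      map_zero' := by
        induction x using ind
        exact sound (Biset.tensor_empty _)
      map_add' := fun y z => by
        induction x using ind; induction y using ind; induction z using ind
        exact sound (Biset.tensor_sum _ _ _) }
  map_zero' := by
    ext y
    induction y using ind
    exact sound (Biset.empty_tensor _)
  map_add' x x' := by
    ext y
    induction x using ind; induction x' using ind; induction y using ind
    exact sound (Biset.sum_tensor _ _ _)

theorem comp_assoc (x : BisetClass L K) (y : BisetClass K H) (z : BisetClass H G) :
    comp (comp x y) z = comp x (comp y z) := by
  induction x using ind; induction y using ind; induction z using ind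
  exact sound (Biset.tensor_assoc _ _ _)

theorem id_comp [Finite H] (x : BisetClass H G) : comp (mk (Biset.id H)) x = x := by
  induction x using ind
  exact sound (Biset.id_tensor _)

theorem comp_id [Finite G] (x : BisetClass H G) : comp x (mk (Biset.id G)) = x := by
  induction x using ind
  exact sound (Biset.tensor_id _)

end BisetClass

/-- The Grothendieck group `B(H, G)` of finite `(H, G)`-bisets. -/
abbrev BisetGroup (H G : Type u) [Group H] [Group G] : Type (u + 1) :=
  Algebra.GrothendieckAddGroup (BisetClass H G)

namespace BisetGroup

variable {L K H G : Type u} [Group L] [Group K] [Group H] [Group G]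

/-- The class of a biset in the Grothendieck group. -/
noncomputable def of (U : Biset H G) : BisetGroup H G :=
  Algebra.GrothendieckAddGroup.of (BisetClass.mk U)

theorem hom_ext {M P : Type*} [AddCommMonoid M] [AddCommGroup P]
    {f g : Algebra.GrothendieckAddGroup M →+ P}
    (h : ∀ x, f (Algebra.GrothendieckAddGroup.of x) = g (Algebra.GrothendieckAddGroup.of x)) :
    f = g :=
  Algebra.GrothendieckAddGroup.lift.symm.injective (AddMonoidHom.ext h)

theorem lift_of {M P : Type*} [AddCommMonoid M] [AddCommGroup P] (f : M →+ P) (x : M) :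
    Algebra.GrothendieckAddGroup.lift f (Algebra.GrothendieckAddGroup.of x) = f x :=
  DFunLike.congr_fun (Algebra.GrothendieckAddGroup.lift.symm_apply_apply f) x

/-- The biadditive extension of the tensor product of bisets to Grothendieck groups. -/
noncomputable def comp : BisetGroup K H →+ BisetGroup H G →+ BisetGroup K G :=
  Algebra.GrothendieckAddGroup.lift
    { toFun := fun x => Algebra.GrothendieckAddGroup.lift
        (Algebra.GrothendieckAddGroup.of.comp (BisetClass.comp x))
      map_zero' := hom_ext fun y => by rw [lift_of]; simp
      map_add' := fun x x' => hom_ext fun y => by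
        rw [AddMonoidHom.add_apply, lift_of, lift_of, lift_of]; simp }

theorem comp_of_of (x : BisetClass K H) (y : BisetClass H G) :
    comp (Algebra.GrothendieckAddGroup.of x) (Algebra.GrothendieckAddGroup.of y) =
      Algebra.GrothendieckAddGroup.of (BisetClass.comp x y) := by
  rw [comp, lift_of]
  exact lift_of _ _

theorem exists_sub {M : Type*} [AddCommMonoid M] (x : Algebra.GrothendieckAddGroup M) :
    ∃ a b : M, x = Algebra.GrothendieckAddGroup.of a - Algebra.GrothendieckAddGroup.of b := by
  induction x using AddLocalization.ind with
  | H p =>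
    obtain ⟨a, b⟩ := p
    refine ⟨a, b, ?_⟩
    have h1 : Algebra.GrothendieckAddGroup.of a = AddLocalization.mk a (0 : (⊤ : AddSubmonoid M)) :=
      (AddLocalization.mk_zero_eq_addMonoidOf_mk a).symm
    have h2 : Algebra.GrothendieckAddGroup.of (b : M) =
        AddLocalization.mk (b : M) (0 : (⊤ : AddSubmonoid M)) :=
      (AddLocalization.mk_zero_eq_addMonoidOf_mk (b : M)).symm
    rw [h1, h2, Algebra.GrothendieckAddGroup.mk_sub_mk]
    congr 1
    · simp
    · ext; simp

theorem comp_assoc (x : BisetGroup L K) (y : BisetGroup K H) (z : BisetGroup H G) :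
    comp (comp x y) z = comp x (comp y z) := by
  obtain ⟨a, a', rfl⟩ := exists_sub x
  obtain ⟨b, b', rfl⟩ := exists_sub y
  obtain ⟨c, c', rfl⟩ := exists_sub z
  simp only [map_sub, AddMonoidHom.sub_apply, comp_of_of, BisetClass.comp_assoc]

theorem id_comp [Finite H] (x : BisetGroup H G) : comp (of (Biset.id H)) x = x := by
  obtain ⟨a, a', rfl⟩ := exists_sub x
  simp only [map_sub, of, comp_of_of, BisetClass.id_comp]

theorem comp_id [Finite G] (x : BisetGroup H G) : comp x (of (Biset.id G)) = x := by
  obtain ⟨a, a', rfl⟩ := exists_sub x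
  simp only [map_sub, AddMonoidHom.sub_apply, of, comp_of_of, BisetClass.comp_id]

end BisetGroup

/-- The `R`-module `RB(H, G) = R ⊗ B(H, G)`. -/
abbrev RB (R : Type v) [CommRing R] (H G : Type u) [Group H] [Group G] : Type (max v (u + 1)) :=
  R ⊗[ℤ] BisetGroup H G

namespace RB

variable (R : Type v) [CommRing R]
variable {L K H G : Type u} [Group L] [Group K] [Group H] [Group G]

/-- The class of a biset in `RB(H, G)`. -/
noncomputable def of (U : Biset H G) : RB R H G := (1 : R) ⊗ₜ[ℤ] BisetGroup.of U

/-- The `R`-bilinear composition `RB(K, H) × RB(H, G) → RB(K, G)` induced by the tensor product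
of bisets. -/
noncomputable def comp : RB R K H →ₗ[R] RB R H G →ₗ[R] RB R K G :=
  LinearMap.liftBaseChange R
    ((LinearMap.baseChangeHom ℤ R (BisetGroup H G) (BisetGroup K G)).comp
      (AddMonoidHom.toIntLinearMap
        { toFun := fun x => (BisetGroup.comp (K := K) (G := G) x).toIntLinearMap
          map_zero' := by ext; simp
          map_add' := fun x y => by ext; simp }))

theorem comp_tmul (r s : R) (x : BisetGroup K H) (y : BisetGroup H G) :
    comp R (r ⊗ₜ[ℤ] x) (s ⊗ₜ[ℤ] y) = (r * s) ⊗ₜ[ℤ] BisetGroup.comp x y := by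
  simp [comp, LinearMap.liftBaseChange_tmul, LinearMap.baseChangeHom, TensorProduct.smul_tmul']

theorem comp_assoc (x : RB R L K) (y : RB R K H) (z : RB R H G) :
    comp R (comp R x y) z = comp R x (comp R y z) := by
  induction x using TensorProduct.induction_on with
  | zero => simp
  | add a b ha hb => simp only [map_add, LinearMap.add_apply, ha, hb]
  | tmul r x =>
    induction y using TensorProduct.induction_on with
    | zero => simp
    | add a b ha hb => simp only [map_add, LinearMap.add_apply, ha, hb]
    | tmul s y =>
      induction z using TensorProduct.induction_on with
      | zero => simp
      | add a b ha hb => simp only [map_add, ha, hb]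
      | tmul t z => simp only [comp_tmul, mul_assoc, BisetGroup.comp_assoc]

theorem id_comp [Finite H] (x : RB R H G) : comp R (of R (Biset.id H)) x = x := by
  induction x using TensorProduct.induction_on with
  | zero => simp
  | add a b ha hb => simp only [map_add, ha, hb]
  | tmul r x => rw [of, comp_tmul, one_mul, BisetGroup.id_comp]

theorem comp_id [Finite G] (x : RB R H G) : comp R x (of R (Biset.id G)) = x := by
  induction x using TensorProduct.induction_on with
  | zero => simp
  | add a b ha hb => simp only [map_add, LinearMap.add_apply, ha, hb]
  | tmul r x => rw [of, comp_tmul, mul_one, BisetGroup.comp_id]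

end RB

/-! ### The biset category -/

/-- A non-empty class of finite groups that is closed under isomorphisms, subgroups, quotients
and direct products. -/
structure GroupClass where
  mem : ∀ (G : Type u) [Group G] [Finite G], Prop
  nonempty : ∃ (G : Type u) (_ : Group G) (_ : Finite G), mem G
  of_iso : ∀ {G G' : Type u} [Group G] [Finite G] [Group G'] [Finite G'],
    (G ≃* G') → mem G → mem G'
  subgroup : ∀ {G : Type u} [Group G] [Finite G] (H : Subgroup G), mem G → mem H
  quotient : ∀ {G : Type u} [Group G] [Finite G] (N : Subgroup G) [N.Normal],
    mem G → mem (G ⧸ N)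
  prod : ∀ {G H : Type u} [Group G] [Finite G] [Group H] [Finite H],
    mem G → mem H → mem (G × H)

/-- The objects of the category `R𝒟`: the finite groups in the class `𝒟`. -/
structure BisetCat (R : Type v) [CommRing R] (D : GroupClass.{u}) where
  carrier : Type u
  [group : Group carrier]
  [finite : Finite carrier]
  mem : D.mem carrier

namespace BisetCat

variable {R : Type v} [CommRing R] {D : GroupClass.{u}}

instance : CoeSort (BisetCat R D) (Type u) := ⟨carrier⟩

attribute [instance] group finite

/-- The biset category on the class `𝒟`: morphisms from `G` to `H` are the elements of
`RB(H, G)`, and composition is induced by the tensor product of bisets. -/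
noncomputable instance : Category (BisetCat R D) where
  Hom G H := RB R H G
  id G := RB.of R (Biset.id G)
  comp f g := RB.comp R g f
  id_comp f := RB.comp_id R f
  comp_id f := RB.id_comp R f
  assoc f g h := (RB.comp_assoc R h g f).symm

noncomputable instance : Preadditive (BisetCat R D) where
  homGroup G H := inferInstanceAs (AddCommGroup (RB R H G))
  add_comp _ _ _ f f' g := LinearMap.map_add (RB.comp R g) f f'
  comp_add _ _ _ f g g' := LinearMap.map_add₂ (RB.comp R) g g' f

noncomputable instance : Linear R (BisetCat R D) where
  homModule G H := inferInstanceAs (Module R (RB R H G))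
  smul_comp _ _ _ r f g := LinearMap.map_smul (RB.comp R g) r f
  comp_smul _ _ _ f r g := LinearMap.map_smul₂ (RB.comp R) r g f

/-- The morphism `G ⟶ H` given by a finite `(H, G)`-biset. -/
noncomputable def ofBiset {G H : BisetCat R D} (U : Biset H G) : G ⟶ H := RB.of R U

/-- A subgroup of a group in the class, as an object. -/
abbrev sub (G : BisetCat R D) (H : Subgroup G) : BisetCat R D where
  carrier := H
  mem := D.subgroup H G.mem

/-- A quotient of a group in the class, as an object. -/
abbrev quot (G : BisetCat R D) (N : Subgroup G) [N.Normal] : BisetCat R D where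
  carrier := G ⧸ N
  mem := D.quotient N G.mem

/-- `Res`: the `(H, G)`-biset `G`. -/
noncomputable def res (G : BisetCat R D) (H : Subgroup G) : G ⟶ G.sub H :=
  ofBiset (Biset.resHom H.subtype)

/-- `Ind`: the `(G, H)`-biset `G`. -/
noncomputable def ind (G : BisetCat R D) (H : Subgroup G) : G.sub H ⟶ G :=
  ofBiset (Biset.indHom H.subtype)

/-- `Inf`: the `(G, G/N)`-biset `G/N`. -/
noncomputable def inf (G : BisetCat R D) (N : Subgroup G) [N.Normal] : G.quot N ⟶ G :=
  ofBiset (Biset.resHom (QuotientGroup.mk' N))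

/-- `Def`: the `(G/N, G)`-biset `G/N`. -/
noncomputable def defl (G : BisetCat R D) (N : Subgroup G) [N.Normal] : G ⟶ G.quot N :=
  ofBiset (Biset.indHom (QuotientGroup.mk' N))

/-- `Iso φ`: the `(G', G)`-biset `G'`, with `G` acting on the right through `φ`. -/
noncomputable def iso {G G' : BisetCat R D} (φ : G ≃* G') : G ⟶ G' :=
  ofBiset (Biset.indHom φ.toMonoidHom)

end BisetCat

/-! ### Green biset functors -/

/-- A Green biset functor over `R𝒟`: an `R`-linear functor `A` from `R𝒟` to `R`-modules such that
each `A(G)` is a unital associative `R`-algebra, and for each group homomorphism `φ : K → G` the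
`(K, G)`-biset `G` induces a unital ring homomorphism `A(G) → A(K)` which, together with the map
`A(K) → A(G)` induced by the `(G, K)`-biset `G`, satisfies the Frobenius identities. -/
structure GreenBisetFunctor (R : Type v) [CommRing R] (D : GroupClass.{u}) where
  toFunctor : BisetCat R D ⥤ ModuleCat.{w} R
  additive : toFunctor.Additive
  linear : toFunctor.Linear R
  mul : ∀ G : BisetCat R D,
    toFunctor.obj G →ₗ[R] toFunctor.obj G →ₗ[R] toFunctor.obj G
  one : ∀ G : BisetCat R D, toFunctor.obj G
  mul_assoc : ∀ (G : BisetCat R D) (a b c : toFunctor.obj G),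
    mul G (mul G a b) c = mul G a (mul G b c)
  one_mul : ∀ (G : BisetCat R D) (a : toFunctor.obj G), mul G (one G) a = a
  mul_one : ∀ (G : BisetCat R D) (a : toFunctor.obj G), mul G a (one G) = a
  res_mul : ∀ {K G : BisetCat R D} (φ : K →* G) (a b : toFunctor.obj G),
    (toFunctor.map (BisetCat.ofBiset (Biset.resHom φ))).hom (mul G a b) =
      mul K ((toFunctor.map (BisetCat.ofBiset (Biset.resHom φ))).hom a)
        ((toFunctor.map (BisetCat.ofBiset (Biset.resHom φ))).hom b)
  res_one : ∀ {K G : BisetCat R D} (φ : K →* G),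
    (toFunctor.map (BisetCat.ofBiset (Biset.resHom φ))).hom (one G) = one K
  frobenius_right : ∀ {K G : BisetCat R D} (φ : K →* G) (a : toFunctor.obj K)
    (b : toFunctor.obj G),
    mul G ((toFunctor.map (BisetCat.ofBiset (Biset.indHom φ))).hom a) b =
      (toFunctor.map (BisetCat.ofBiset (Biset.indHom φ))).hom
        (mul K a ((toFunctor.map (BisetCat.ofBiset (Biset.resHom φ))).hom b))
  frobenius_left : ∀ {K G : BisetCat R D} (φ : K →* G) (a : toFunctor.obj K)
    (b : toFunctor.obj G),
    mul G b ((toFunctor.map (BisetCat.ofBiset (Biset.indHom φ))).hom a) =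
      (toFunctor.map (BisetCat.ofBiset (Biset.indHom φ))).hom
        (mul K ((toFunctor.map (BisetCat.ofBiset (Biset.resHom φ))).hom b) a)

namespace GreenBisetFunctor

variable {R : Type v} [CommRing R] {D : GroupClass.{u}} (A : GreenBisetFunctor.{u, v, w} R D)

/-- The evaluation `A(G)`. -/
def eval (G : BisetCat R D) : Type w := A.toFunctor.obj G

instance (G : BisetCat R D) : AddCommGroup (A.eval G) :=
  inferInstanceAs (AddCommGroup (A.toFunctor.obj G))

instance (G : BisetCat R D) : Module R (A.eval G) :=
  inferInstanceAs (Module R (A.toFunctor.obj G))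

/-- The ring structure of `A(G)`. -/
instance (G : BisetCat R D) : Ring (A.eval G) where
  __ := (inferInstance : AddCommGroup (A.eval G))
  mul a b := A.mul G a b
  one := A.one G
  mul_assoc := A.mul_assoc G
  one_mul := A.one_mul G
  mul_one := A.mul_one G
  left_distrib a b c := map_add (A.mul G a) b c
  right_distrib a b c := LinearMap.map_add₂ (A.mul G) a b c
  zero_mul a := LinearMap.map_zero₂ (A.mul G) a
  mul_zero a := map_zero (A.mul G a)

/-- The `R`-algebra structure of `A(G)`. -/
instance (G : BisetCat R D) : Algebra R (A.eval G) :=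
  Algebra.ofModule (fun r a b => LinearMap.map_smul₂ (A.mul G) r a b)
    (fun r a b => map_smul (A.mul G a) r b)

/-- The `R`-linear map `A(f) : A(G) → A(H)` for a morphism `f : G ⟶ H` in `R𝒟`. -/
def act {G H : BisetCat R D} (f : G ⟶ H) : A.eval G →ₗ[R] A.eval H := (A.toFunctor.map f).hom

end GreenBisetFunctor

/-! ### Split semisimple algebras and primitive idempotents -/

/-- A finite dimensional algebra over a field is split semisimple if it is isomorphic to a finite
direct product of full matrix algebras over the field. -/
def IsSplitSemisimple (𝕂 : Type v) [Field 𝕂] (B : Type w) [Ring B] [Algebra 𝕂 B] : Prop :=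
  ∃ (n : ℕ) (d : Fin n → ℕ), (∀ i, 0 < d i) ∧
    Nonempty (B ≃ₐ[𝕂] ∀ i : Fin n, Matrix (Fin (d i)) (Fin (d i)) 𝕂)

/-- A primitive idempotent: a nonzero idempotent that is not the sum of two nonzero orthogonal
idempotents. -/
structure IsPrimitiveIdempotent {B : Type w} [Ring B] (e : B) : Prop where
  idem : e * e = e
  ne_zero : e ≠ 0
  primitive : ∀ a b : B, a * a = a → b * b = b → a * b = 0 → b * a = 0 → e = a + b →
    a = 0 ∨ b = 0

/-- The set `E_G` of primitive idempotents of `A(G)`. -/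
def GreenBisetFunctor.E {R : Type v} [CommRing R] {D : GroupClass.{u}}
    (A : GreenBisetFunctor.{u, v, w} R D) (G : BisetCat R D) : Set (A.eval G) :=
  {e | IsPrimitiveIdempotent e}

/-! All five operations come from a group homomorphism `φ : K → G`. Restriction and inflation are
`φ^*` for the inclusion of a subgroup and for the quotient map; induction and deflation are `φ_*`
for the same two maps. So (a) and (c) are one statement about `φ^*`, and (b) and (d) one statement
about `φ_*`.

A commutative split semisimple algebra is a finite power of `𝕂`. Its idempotents are the 0-1
vectors, hence sums of distinct coordinate idempotents, and its primitive idempotents are the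
coordinate idempotents, each spanning an ideal that is a line.

The map `φ^*` is a ring homomorphism, so it sends `e` to an idempotent, which is such a sum. For
`φ_*`, the Frobenius identity gives `b · φ_*(t) = φ_*(φ^*(b) · t)`. Since `φ^*(b) · t` is a multiple
of `t`, the element `φ_*(t)` is an eigenvector of every multiplication; in a power of `𝕂` such a
vector is supported on at most one coordinate, so it is a multiple of a primitive idempotent.

For (e), the biset of `φ_*` with `φ` an isomorphism is also the biset of `(φ⁻¹)^*`. Thus `A(Iso φ)`
is a ring isomorphism and preserves primitive idempotents. -/

/-! ### Split semisimple commutative algebras -/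

section SplitCommutative

variable {𝕂 : Type*} [Field 𝕂] {B : Type*} [Ring B] [Algebra 𝕂 B]

/-- A commutative split semisimple algebra is a finite power of the base field. -/
theorem IsSplitSemisimple.exists_algEquiv_pi (h : IsSplitSemisimple 𝕂 B)
    (hcomm : ∀ a b : B, a * b = b * a) : ∃ n : ℕ, Nonempty (B ≃ₐ[𝕂] (Fin n → 𝕂)) := by
  obtain ⟨n, d, hd, ⟨f⟩⟩ := h
  -- Commutativity of `B` passes to each matrix block, by placing `M` and `N` in the `i`-th factor
  -- and zero elsewhere.
  have hc : ∀ i, ∀ M N : Matrix (Fin (d i)) (Fin (d i)) 𝕂, M * N = N * M := by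
    intro i M N
    have h1 := congrArg f (hcomm (f.symm (Pi.single i M)) (f.symm (Pi.single i N)))
    simp only [map_mul, AlgEquiv.apply_symm_apply] at h1
    simpa using congrFun h1 i
  have h1 : ∀ i, d i = 1 := by
    intro i
    by_contra hne
    have h2 : 1 < d i := lt_of_le_of_ne (hd i) (Ne.symm hne)
    -- In size at least two, `E₀₁E₁₀ = E₀₀` and `E₁₀E₀₁ = E₁₁` differ at entry `(0, 0)`.
    have h3 := hc i (Matrix.single ⟨0, hd i⟩ ⟨1, h2⟩ 1) (Matrix.single ⟨1, h2⟩ ⟨0, hd i⟩ 1)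
    have h4 := congrFun (congrFun h3 ⟨0, hd i⟩) ⟨0, hd i⟩
    simp at h4
  obtain rfl : d = fun _ => 1 := funext h1
  let e : 𝕂 ≃ₐ[𝕂] Matrix (Fin 1) (Fin 1) 𝕂 :=
    AlgEquiv.ofBijective (Algebra.ofId 𝕂 _) ⟨(algebraMap 𝕂 _).injective, fun M => ⟨M 0 0, by
      ext i j
      rw [Subsingleton.elim i 0, Subsingleton.elim j 0]
      simp [Algebra.ofId_apply, Matrix.algebraMap_matrix_apply]⟩⟩
  exact ⟨n, ⟨f.trans (AlgEquiv.piCongrRight fun _ => e.symm)⟩⟩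

variable {n : ℕ}


theorem mul_self_eq_self_apply (f : B ≃ₐ[𝕂] (Fin n → 𝕂)) {a : B} (ha : a * a = a)
    (i : Fin n) : f a i = 0 ∨ f a i = 1 := by
  have h := congrFun (congrArg f ha) i
  rw [map_mul, Pi.mul_apply] at h
  rcases eq_or_ne (f a i) 0 with h0 | h0
  · exact Or.inl h0
  · exact Or.inr ((mul_eq_left₀ h0).mp h)

/-- At a coordinate other than `i`, both the sum and the product of the two summands vanish, so both
are zero there. At `i` the product vanishes, so one summand is zero there as well, hence zero
everywhere. -/
theorem isPrimitiveIdempotent_symm_single (f : B ≃ₐ[𝕂] (Fin n → 𝕂)) (i : Fin n) :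
    IsPrimitiveIdempotent (f.symm (Pi.single i 1)) where
  idem := by rw [← map_mul, ← Pi.single_mul, mul_one]
  ne_zero := by simp
  primitive a b ha hb hab _ h := by
    have hs : f a + f b = Pi.single i 1 := by rw [← map_add, ← h, AlgEquiv.apply_symm_apply]
    have hm : f a * f b = 0 := by rw [← map_mul, hab, map_zero]
    have hz : ∀ j, j ≠ i → f a j = 0 ∧ f b j = 0 := by
      intro j hj
      have h1 : f a j + f b j = 0 := by simpa [hj] using congrFun hs j
      have h2 : f a j * f b j = 0 := congrFun hm j
      rcases mul_eq_zero.mp h2 with h3 | h3 <;> simp_all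
    rcases mul_eq_zero.mp (congrFun hm i : f a i * f b i = 0) with h3 | h3
    · left
      refine (map_eq_zero_iff f f.injective).mp (funext fun j => ?_)
      by_cases hj : j = i
      · rw [hj, h3]; rfl
      · exact (hz j hj).1
    · right
      refine (map_eq_zero_iff f f.injective).mp (funext fun j => ?_)
      by_cases hj : j = i
      · rw [hj, h3]; rfl
      · exact (hz j hj).2

/-- The coordinate idempotents are simultaneous eigenvectors of all multiplications, with the
coordinates as eigenvalues. -/
theorem mul_symm_single (f : B ≃ₐ[𝕂] (Fin n → 𝕂)) (a : B) (i : Fin n) :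
    a * f.symm (Pi.single i 1) = f a i • f.symm (Pi.single i 1) := by
  apply f.injective
  rw [map_mul, map_smul, AlgEquiv.apply_symm_apply]
  ext j
  by_cases hj : j = i
  · subst hj; simp
  · simp [hj]

/-- If `t` is nonzero at `i`, it equals 1 there, so `t` splits orthogonally as `eᵢ + (t - eᵢ)` with
`eᵢ` the `i`-th coordinate idempotent. Primitivity forces the second summand to vanish. -/
theorem IsPrimitiveIdempotent.eq_symm_single (f : B ≃ₐ[𝕂] (Fin n → 𝕂)) {t : B} (ht : IsPrimitiveIdempotent t) :
    ∃ i, t = f.symm (Pi.single i 1) := by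
  obtain ⟨i, hi⟩ : ∃ i, f t i ≠ 0 := by
    by_contra! h
    exact ht.ne_zero ((map_eq_zero_iff f f.injective).mp (funext h))
  have h1 : f t i = 1 := (mul_self_eq_self_apply f ht.idem i).resolve_left hi
  have hs := isPrimitiveIdempotent_symm_single f i
  have hl : t * f.symm (Pi.single i 1) = f.symm (Pi.single i 1) := by
    rw [mul_symm_single, h1, one_smul]
  -- `B` is only declared a ring; its commutativity is borrowed from `Fin n → 𝕂` through `f`.
  have hr : f.symm (Pi.single i 1) * t = f.symm (Pi.single i 1) := by
    apply f.injective
    rw [map_mul, mul_comm, ← map_mul, hl]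
  refine ⟨i, ?_⟩
  rcases ht.primitive (f.symm (Pi.single i 1)) (t - f.symm (Pi.single i 1)) hs.idem
    (by rw [sub_mul, mul_sub, mul_sub, ht.idem, hl, hr, hs.idem, sub_self, sub_zero])
    (by rw [mul_sub, hr, hs.idem, sub_self]) (by rw [sub_mul, hl, hs.idem, sub_self])
    (by abel) with h | h
  · exact (hs.ne_zero h).elim
  · exact sub_eq_zero.mp h

/-- An idempotent of a split commutative algebra is a sum of distinct primitive idempotents. -/
theorem exists_sum_primitive_of_idem (f : B ≃ₐ[𝕂] (Fin n → 𝕂)) {a : B} (ha : a * a = a) :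
    ∃ Ω : Finset B, (Ω : Set B) ⊆ {e | IsPrimitiveIdempotent e} ∧ a = ∑ s ∈ Ω, s := by
  classical
  have hinj : Function.Injective fun i : Fin n => f.symm (Pi.single i 1) := by
    intro i j hij
    by_contra hne
    have h := congrFun (f.symm.injective hij) i
    simp [hne] at h
  refine ⟨(Finset.univ.filter fun i => f a i = 1).image fun i => f.symm (Pi.single i 1), ?_, ?_⟩
  · intro e he
    obtain ⟨i, -, rfl⟩ := Finset.mem_image.mp (Finset.mem_coe.mp he)
    exact isPrimitiveIdempotent_symm_single f i
  -- Distinct indices give distinct idempotents, so the sum over the image set loses no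
  -- multiplicity.
  · rw [Finset.sum_image fun i _ j _ h => hinj h, ← map_sum]
    apply f.injective
    rw [AlgEquiv.apply_symm_apply]
    ext j
    rw [Finset.sum_apply]
    rcases mul_self_eq_self_apply f ha j with h | h <;>
      simp [Pi.single_apply, h]

theorem IsPrimitiveIdempotent.exists_mul_eq_smul (f : B ≃ₐ[𝕂] (Fin n → 𝕂)) {t : B} (ht : IsPrimitiveIdempotent t)
    (a : B) :
    ∃ c : 𝕂, a * t = c • t := by
  obtain ⟨i, rfl⟩ := IsPrimitiveIdempotent.eq_symm_single f ht
  exact ⟨f a i, mul_symm_single f a i⟩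

/-- An element spanning an ideal of dimension at most one is a multiple of a primitive
idempotent. -/
theorem exists_eq_smul_primitive (f : B ≃ₐ[𝕂] (Fin n → 𝕂)) [Nontrivial B] {x : B}
    (hx : ∀ b : B, ∃ c : 𝕂, b * x = c • x) :
    ∃ c : 𝕂, ∃ e : B, IsPrimitiveIdempotent e ∧ x = c • e := by
  -- For `x = 0` any primitive idempotent works with scalar 0; one exists because a nontrivial
  -- algebra has at least one coordinate.
  by_cases h0 : x = 0
  · have : Nonempty (Fin n) := by
      by_contra h
      rw [not_nonempty_iff] at h
      exact one_ne_zero (f.injective (Subsingleton.elim (f 1) (f 0)))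
    obtain ⟨i⟩ := this
    exact ⟨0, _, isPrimitiveIdempotent_symm_single f i, by rw [h0, zero_smul]⟩
  · obtain ⟨i, hi⟩ : ∃ i, f x i ≠ 0 := by
      by_contra! h
      exact h0 ((map_eq_zero_iff f f.injective).mp (funext h))
    refine ⟨f x i, _, isPrimitiveIdempotent_symm_single f i, ?_⟩
    -- Multiplication by `eᵢ` scales `x` by some `c`. Comparing `i`-th coordinates gives `c = 1`, so
    -- `x = eᵢ x` is supported at `i`.
    obtain ⟨c, hc⟩ := hx (f.symm (Pi.single i 1))
    have h1 := congrArg f hc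
    rw [map_mul, map_smul, AlgEquiv.apply_symm_apply] at h1
    have hc1 : c = 1 := by
      have h2 := congrFun h1 i
      simp only [Pi.mul_apply, Pi.single_eq_same, one_mul, Pi.smul_apply, smul_eq_mul] at h2
      exact (mul_eq_right₀ hi).mp h2.symm
    apply f.injective
    rw [map_smul, AlgEquiv.apply_symm_apply]
    rw [hc1, one_smul] at h1
    rw [← h1]
    ext j
    by_cases hj : j = i
    · subst hj; simp
    · simp [hj]

end SplitCommutative

theorem IsPrimitiveIdempotent.map_ringEquiv {B C : Type*} [Ring B] [Ring C] (g : B ≃+* C) {e : B}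
    (he : IsPrimitiveIdempotent e) : IsPrimitiveIdempotent (g e) where
  idem := by rw [← map_mul, he.idem]
  ne_zero := (map_ne_zero_iff g g.injective).mpr he.ne_zero
  primitive a b ha hb hab hba h := by
    have := he.primitive (g.symm a) (g.symm b) (by rw [← map_mul, ha]) (by rw [← map_mul, hb])
      (by rw [← map_mul, hab, map_zero]) (by rw [← map_mul, hba, map_zero])
      (by rw [← map_add, ← h, RingEquiv.symm_apply_apply])
    simpa using this

/-! ### Bisets attached to an isomorphism of groups -/

namespace Biset

variable {K G : Type u} [Group K] [Group G] [Finite K] [Finite G]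

/-- The bijection `φ⁻¹` itself intertwines the actions. This lets `φ_*` inherit the multiplicativity
of `(φ⁻¹)^*`. -/
theorem isomorphic_indHom_resHom_symm (φ : K ≃* G) :
    Isomorphic (indHom φ.toMonoidHom) (resHom φ.symm.toMonoidHom) :=
  Isomorphic.mk' (U := indHom φ.toMonoidHom) (V := resHom φ.symm.toMonoidHom) φ.symm φ
    φ.apply_symm_apply φ.symm_apply_apply
    (fun h x => map_mul φ.symm h x)
    (fun g (x : G) => (map_mul φ.symm x (φ g.unop)).trans
      (congrArg (fun t => φ.symm x * t) (φ.symm_apply_apply g.unop)))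

/-- The map is `(x, y) ↦ φ(x)y`, with inverse `y ↦ (1, y)`. Applying `A` shows that `(φ⁻¹)^*` undoes
`φ^*`. -/
theorem isomorphic_tensor_resHom_symm (φ : K ≃* G) :
    Isomorphic (tensor (resHom φ.symm.toMonoidHom) (resHom φ.toMonoidHom)) (id G) :=
  Isomorphic.mk' (U := tensor (resHom φ.symm.toMonoidHom) (resHom φ.toMonoidHom)) (V := id G)
    (tlift (U := resHom φ.symm.toMonoidHom) (V := resHom φ.toMonoidHom)
      (fun (x : K) (y : G) => (φ x * y : G))
      (fun h (x : K) (y : G) => by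
        change φ (x * h) * y = φ x * (φ h * y)
        rw [map_mul, mul_assoc]))
    (fun y : G => tmk (resHom φ.symm.toMonoidHom) (resHom φ.toMonoidHom) (1 : K) y)
    (tind fun (x : K) (y : G) => by
      refine (tmk_eq (resHom φ.symm.toMonoidHom) (resHom φ.toMonoidHom) x (1 : K) y).symm.trans ?_
      exact congrArg
        (fun t : K => tmk (resHom φ.symm.toMonoidHom) (resHom φ.toMonoidHom) t y) (one_mul x))
    (fun y : G => by
      change φ 1 * y = y
      rw [map_one, one_mul])
    (fun h => tind fun (x : K) (y : G) => by
      change φ (φ.symm h * x) * y = h * (φ x * y)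
      rw [map_mul, MulEquiv.apply_symm_apply, mul_assoc])
    (fun g => tind fun (x : K) (y : G) => (mul_assoc (φ x) y g.unop).symm)

end Biset

/-! ### Restriction and induction maps of Green biset functors -/

namespace BisetCat

variable {R : Type v} [CommRing R] {D : GroupClass.{u}}

theorem ofBiset_congr {G H : BisetCat R D} {U V : Biset H G} (h : Biset.Isomorphic U V) :
    (ofBiset U : G ⟶ H) = ofBiset V :=
  congrArg (fun x => (1 : R) ⊗ₜ[ℤ] Algebra.GrothendieckAddGroup.of x) (BisetClass.sound h)

theorem ofBiset_comp {G H K : BisetCat R D} (V : Biset H G) (U : Biset K H) :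
    (ofBiset V : G ⟶ H) ≫ ofBiset U = ofBiset (Biset.tensor U V) := by
  refine (RB.comp_tmul R 1 1 (BisetGroup.of U) (BisetGroup.of V)).trans ?_
  rw [one_mul, BisetGroup.of, BisetGroup.of, BisetGroup.comp_of_of]
  rfl

end BisetCat

namespace GreenBisetFunctor

variable {R : Type v} [CommRing R] {D : GroupClass.{u}} (A : GreenBisetFunctor.{u, v, w} R D)
  {K G : BisetCat R D}

/-- The ring homomorphism `φ^* : A(G) → A(K)`. -/
noncomputable def pullback (φ : K →* G) : A.eval G →+* A.eval K where
  toFun := A.act (BisetCat.ofBiset (Biset.resHom φ))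
  map_one' := A.res_one φ
  map_mul' := A.res_mul φ
  map_zero' := map_zero _
  map_add' := map_add _

/-- The Frobenius identity makes `φ_*` linear over `A(G)`, acting on `A(K)` through `φ^*`. -/
theorem mul_act_indHom (φ : K →* G) (a : A.eval K) (b : A.eval G) :
    b * A.act (BisetCat.ofBiset (Biset.indHom φ)) a =
      A.act (BisetCat.ofBiset (Biset.indHom φ)) (A.pullback φ b * a) :=
  A.frobenius_left φ a b

theorem pullback_comp_pullback_symm (φ : K ≃* G) (x : A.eval G) :
    A.pullback φ.symm.toMonoidHom (A.pullback φ.toMonoidHom x) = x := by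
  have h : A.toFunctor.map (BisetCat.ofBiset (Biset.resHom φ.toMonoidHom)) ≫
      A.toFunctor.map (BisetCat.ofBiset (Biset.resHom φ.symm.toMonoidHom)) = 𝟙 _ := by
    rw [← A.toFunctor.map_comp, BisetCat.ofBiset_comp,
      BisetCat.ofBiset_congr (Biset.isomorphic_tensor_resHom_symm φ)]
    exact A.toFunctor.map_id G
  exact congrArg (fun t => t.hom x) h

/-- The ring isomorphism `A(K) ≃ A(G)` induced by a group isomorphism. -/
noncomputable def mapEquiv (φ : K ≃* G) : A.eval K ≃+* A.eval G :=
  RingEquiv.ofRingHom (A.pullback φ.symm.toMonoidHom) (A.pullback φ.toMonoidHom)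
    (RingHom.ext (A.pullback_comp_pullback_symm φ))
    (RingHom.ext (A.pullback_comp_pullback_symm φ.symm))

theorem act_iso_eq_mapEquiv (φ : K ≃* G) (x : A.eval K) :
    A.act (BisetCat.iso φ) x = A.mapEquiv φ x := by
  rw [BisetCat.iso, BisetCat.ofBiset_congr (Biset.isomorphic_indHom_resHom_symm φ)]
  rfl

end GreenBisetFunctor

/-! ### Images of primitive idempotents under `φ^*` and `φ_*` -/

namespace GreenBisetFunctor

variable {𝕂 : Type v} [Field 𝕂] {D : GroupClass.{u}} (A : GreenBisetFunctor.{u, v, w} 𝕂 D)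
  {K G : BisetCat 𝕂 D}

/-- The map `φ^*` sends a primitive idempotent to a sum of distinct primitive idempotents. -/
theorem exists_act_resHom_eq_sum (hK_comm : ∀ a b : A.eval K, a * b = b * a)
    (hK : IsSplitSemisimple 𝕂 (A.eval K)) (φ : K →* G) {e : A.eval G} (he : e ∈ A.E G) :
    ∃ Ω : Finset (A.eval K), (Ω : Set (A.eval K)) ⊆ A.E K ∧
      A.act (BisetCat.ofBiset (Biset.resHom φ)) e = ∑ s ∈ Ω, s := by
  obtain ⟨n, ⟨f⟩⟩ := hK.exists_algEquiv_pi hK_comm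
  exact exists_sum_primitive_of_idem f (a := A.pullback φ e) (by rw [← map_mul, he.idem])

/-- The map `φ_*` sends a primitive idempotent to a multiple of a primitive idempotent. -/
theorem exists_act_indHom_eq_smul (h_comm : ∀ (G : BisetCat 𝕂 D) (a b : A.eval G), a * b = b * a)
    (h_split : ∀ G : BisetCat 𝕂 D, IsSplitSemisimple 𝕂 (A.eval G)) (φ : K →* G)
    {t : A.eval K} (ht : t ∈ A.E K) :
    ∃ c : 𝕂, ∃ e : A.eval G, e ∈ A.E G ∧
      A.act (BisetCat.ofBiset (Biset.indHom φ)) t = c • e := by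
  obtain ⟨n, ⟨f⟩⟩ := (h_split G).exists_algEquiv_pi (h_comm G)
  obtain ⟨m, ⟨g⟩⟩ := (h_split K).exists_algEquiv_pi (h_comm K)
  have : Nontrivial (A.eval K) := ⟨t, 0, ht.ne_zero⟩
  -- As `φ^*` is unital with nonzero target, `A(G)` is nonzero. This supplies a primitive idempotent
  -- even when `φ_*(t) = 0`.
  have : Nontrivial (A.eval G) := (A.pullback φ).domain_nontrivial
  refine exists_eq_smul_primitive f fun b => ?_
  obtain ⟨c, hc⟩ := IsPrimitiveIdempotent.exists_mul_eq_smul g ht (A.pullback φ b)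
  exact ⟨c, by rw [mul_act_indHom, hc, map_smul]⟩

end GreenBisetFunctor

theorem mainTheorem2 {𝕂 : Type v} [Field 𝕂] [CharZero 𝕂] (D : GroupClass.{u})
    (A : GreenBisetFunctor.{u, v, w} 𝕂 D)
    (hA_fin : ∀ G : BisetCat 𝕂 D, Module.Finite 𝕂 (A.eval G))
    (hA_comm : ∀ (G : BisetCat 𝕂 D) (a b : A.eval G), a * b = b * a)
    (hA_split : ∀ G : BisetCat 𝕂 D, IsSplitSemisimple 𝕂 (A.eval G))
    (G : BisetCat 𝕂 D) :
    (∀ (H : Subgroup G), ∀ e ∈ A.E G,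
      ∃ Ω : Finset (A.eval (G.sub H)), (Ω : Set (A.eval (G.sub H))) ⊆ A.E (G.sub H) ∧
        A.act (G.res H) e = ∑ s ∈ Ω, s) ∧
    (∀ (H : Subgroup G), ∀ t ∈ A.E (G.sub H),
      ∃ e ∈ A.E G, ∃ c : 𝕂, A.act (G.ind H) t = c • e) ∧
    (∀ (N : Subgroup G) [N.Normal], ∀ e ∈ A.E (G.quot N),
      ∃ Ω : Finset (A.eval G), (Ω : Set (A.eval G)) ⊆ A.E G ∧
        A.act (G.inf N) e = ∑ t ∈ Ω, t) ∧
    (∀ (N : Subgroup G) [N.Normal], ∀ e ∈ A.E G,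
      ∃ c : 𝕂, ∃ t ∈ A.E (G.quot N), A.act (G.defl N) e = c • t) ∧
    (∀ (G' : BisetCat 𝕂 D) (φ : G ≃* G'), ∀ e ∈ A.E G,
      ∃ e' ∈ A.E G', A.act (BisetCat.iso φ) e = e') := by
  refine ⟨fun H e he => ?_, fun H t ht => ?_, fun N _ e he => ?_, fun N _ e he => ?_,
    fun G' φ e he => ?_⟩
  · exact A.exists_act_resHom_eq_sum (K := G.sub H) (hA_comm _) (hA_split _) H.subtype he
  · obtain ⟨c, e, he, h⟩ := A.exists_act_indHom_eq_smul (K := G.sub H) hA_comm hA_split H.subtype ht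
    exact ⟨e, he, c, h⟩
  -- The quotient map goes from `G` to `G/N`, so here `G` plays the role of the source `K`.
  · exact A.exists_act_resHom_eq_sum (hA_comm _) (hA_split _) (K := G) (G := G.quot N)
      (QuotientGroup.mk' N) he
  · exact A.exists_act_indHom_eq_smul (K := G) (G := G.quot N) hA_comm hA_split (QuotientGroup.mk' N) he
  · rw [A.act_iso_eq_mapEquiv]
    exact ⟨_, IsPrimitiveIdempotent.map_ringEquiv _ he, rfl⟩
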